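/- Fix $\sigma>0$, $A>0$ and a real random variable $h$ with an arbitrary distribution. In the slow fading channel $\mathcal G_{slow}$ the input $\mathbf x\in\mathbb R^n$ produces the output $\mathbf y=h\mathbf x+\mathbf z$, where $\mathbf z$ has i.i.d. $N(0,\sigma^2)$ coordinates, with density $f_{\mathbf z}$, and is independent of $h$; the receiver knows $h$ (channel side information, CSI). For $\eta\in\mathbb R$, an $(M,n,\lambda_1,\lambda_2,\eta)$ deterministic identification (DI) code consists of codewords $\mathbf u_1,\dots,\mathbf u_M\in\mathbb R^n$ with $\|\mathbf u_i\|_2^2\le nA$ and measurable decoding regions $D_{i,x}\subset\mathbb R^n$ ($1\le i\le M$, $x\in\mathbb R$) such that, for some Borel set $H_0\subset\mathbb R$ with $\mathbb P(h\in H_0)\ge 1-\eta$, $$\int_{D_{i,x}^c} f_{\mathbf z}(\mathbf y-x\mathbf u_i)\,d\mathbf y\le\lambda_1,\qquad \int_{D_{j,x}} f_{\mathbf z}(\mathbf y-x\mathbf u_i)\,d\mathbf y\le\lambda_2$$ for all $x\in H_0$ and all $i\ne j$ (the first inequality for all $i$). A rate $R>0$ is achievable for the outage probability $\eta$ if for all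 $\lambda_1,\lambda_2>0$ and all sufficiently large $n$ there is a $(\lceil n^{nR}\rceil,n,\lambda_1,\lambda_2,\eta)$ DI code. The capacity $C_{DI}^{CSI}(\mathcal G_{slow},\eta)$ is the supremum of the achievable rates ($0$ if there are none). 1. If $\eta<\mathbb P(h=0)$, then $C_{DI}^{CSI}(\mathcal G_{slow},\eta)=0$. In fact, every $(M,n,\lambda_1,\lambda_2,\eta)$ DI code with $\lambda_1+\lambda_2<1$ has $M\le 1$. 2. If $\mathbb P(h=0)<\eta<1$, then $$\frac14\le C_{DI}^{CSI}(\mathcal G_{slow},\eta)\le\frac12 .$$ -/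

import Mathlib

open MeasureTheory Filter
open scoped ENNReal

noncomputable section

namespace SlowFading

/-- The density of the noise vector `(z₁, …, zₙ)`, whose coordinates are i.i.d. `N(0, σ²)`. -/
def noiseDensity (σ : ℝ) (n : ℕ) (z : EuclideanSpace ℝ (Fin n)) : ℝ :=
  1 / (2 * Real.pi * σ ^ 2) ^ ((n : ℝ) / 2) * Real.exp (-‖z‖ ^ 2 / (2 * σ ^ 2))

/-- A system of `M` codewords in `ℝⁿ` under the input constraint `A`, with decoding regions that
may depend on the fading coefficient (which the receiver knows). -/
structure DICode (M n : ℕ) (A : ℝ) where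
  /-- the codewords `uᵢ` -/
  codeword : Fin M → EuclideanSpace ℝ (Fin n)
  /-- the decoding regions `D_{i,h}` -/
  region : Fin M → ℝ → Set (EuclideanSpace ℝ (Fin n))
  norm_sq_le : ∀ i, ‖codeword i‖ ^ 2 ≤ n * A
  measurableSet_region : ∀ i h, MeasurableSet (region i h)

namespace DICode

variable {M n : ℕ} {A : ℝ}

/-- Type I (missed identification) error for the identity `i` and the fading coefficient `h`. -/
def errorI (𝒞 : DICode M n A) (σ : ℝ) (i : Fin M) (h : ℝ) : ℝ :=
  ∫ y in (𝒞.region i h)ᶜ, noiseDensity σ n (y - h • 𝒞.codeword i)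

/-- Type II (false identification) error: `i` is sent, and the receiver that expects `j`
accepts. -/
def errorII (𝒞 : DICode M n A) (σ : ℝ) (i j : Fin M) (h : ℝ) : ℝ :=
  ∫ y in 𝒞.region j h, noiseDensity σ n (y - h • 𝒞.codeword i)

/-- The code is an `(M, n, lam₁, lam₂, η)` DI code: off an outage event of probability at most `η`,
all errors, uniformly in the fading coefficient, are at most `lam₁` and `lam₂`. -/
def IsReliable {Ω : Type*} [MeasurableSpace Ω] (𝒞 : DICode M n A) (σ : ℝ) (P : Measure Ω)
    (h : Ω → ℝ) (lam₁ lam₂ η : ℝ) : Prop :=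
  ∃ H₀ : Set ℝ, MeasurableSet H₀ ∧ 1 - η ≤ P.real {ω | h ω ∈ H₀} ∧
    (∀ i, ∀ x ∈ H₀, 𝒞.errorI σ i x ≤ lam₁) ∧
    (∀ i j, i ≠ j → ∀ x ∈ H₀, 𝒞.errorII σ i j x ≤ lam₂)

end DICode

/-- There is an `(M, n, lam₁, lam₂, η)` DI code for the slow fading channel with noise variance
`σ²`, fading coefficient `h` and input constraint `A`. -/
def ExistsDICode {Ω : Type*} [MeasurableSpace Ω] (σ A : ℝ) (P : Measure Ω) (h : Ω → ℝ)
    (M n : ℕ) (lam₁ lam₂ η : ℝ) : Prop :=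
  ∃ 𝒞 : DICode M n A, 𝒞.IsReliable σ P h lam₁ lam₂ η

/-- The rate `R > 0` is achievable for the outage probability `η`. The number `n ^ (n R)` of
codewords is rounded up to an integer. -/
def IsAchievable {Ω : Type*} [MeasurableSpace Ω] (σ A : ℝ) (P : Measure Ω) (h : Ω → ℝ)
    (η R : ℝ) : Prop :=
  0 < R ∧ ∀ lam₁ lam₂ : ℝ, 0 < lam₁ → 0 < lam₂ →
    ∀ᶠ n : ℕ in atTop, ExistsDICode σ A P h ⌈(n : ℝ) ^ ((n : ℝ) * R)⌉₊ n lam₁ lam₂ η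

/-- The `η`-outage DI capacity with channel side information: the supremum, in `[0, ∞]`, of the
achievable rates (it is `0` if there are none). -/
def capacity {Ω : Type*} [MeasurableSpace Ω] (σ A : ℝ) (P : Measure Ω) (h : Ω → ℝ)
    (η : ℝ) : ℝ≥0∞ :=
  ⨆ (R : ℝ) (_ : IsAchievable σ A P h η R), ENNReal.ofReal R

end SlowFading

end

-- At fading `0` the output law forgets the codeword. If `η < P(h = 0)`, then `0` cannot be excluded
-- from `H₀`, and two identities would have errors of opposite types summing to 1.
--
-- Lower bound: outage removes a neighbourhood of `0`, so `γ ≤ |x|`. The receiver accepts a ball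
-- around `x • u i`. Squared noise norms fluctuate on the scale `√n`, so distances slightly above
-- `n^(1/4)` suffice (`setIntegral_typicalBall_le`), and greedy packing in radius `√(nA)` gives
-- about `n^(n/4)` codewords.
--
-- Upper bound: with `|x| ≤ K`, small errors keep codewords a constant distance apart
-- (`DICode.IsReliable.le_norm_sub`), and volume allows only `(C√n)^n` of them. The gap between 1/4
-- and 1/2 is the gap between these two distances.

namespace SlowFading

-- Gaussian estimates

section Noise

variable {σ : ℝ} {n : ℕ}

lemma noiseDensity_nonneg (σ : ℝ) (n : ℕ) (z : EuclideanSpace ℝ (Fin n)) :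
    0 ≤ noiseDensity σ n z := by
  unfold noiseDensity
  positivity

lemma integral_noiseDensity (hσ : 0 < σ) (n : ℕ) : ∫ z, noiseDensity σ n z = 1 := by
  have h := GaussianFourier.integral_rexp_neg_mul_sq_norm
    (V := EuclideanSpace ℝ (Fin n)) (b := 1 / (2 * σ ^ 2)) (by positivity)
  have e : ∀ z : EuclideanSpace ℝ (Fin n), noiseDensity σ n z =
      1 / (2 * Real.pi * σ ^ 2) ^ ((n : ℝ) / 2) * Real.exp (-(1 / (2 * σ ^ 2)) * ‖z‖ ^ 2) := by
    intro z
    rw [noiseDensity]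
    congr 2
    ring
  simp_rw [e]
  rw [integral_const_mul, h, finrank_euclideanSpace_fin,
    show Real.pi / (1 / (2 * σ ^ 2)) = 2 * Real.pi * σ ^ 2 by field_simp]
  have : 0 < (2 * Real.pi * σ ^ 2) ^ ((n : ℝ) / 2) := by positivity
  field_simp

lemma integrable_noiseDensity (hσ : 0 < σ) (n : ℕ) : Integrable (noiseDensity σ n) := by
  by_contra h
  have := integral_noiseDensity hσ n
  rw [integral_undef h] at this
  exact zero_ne_one this

lemma integral_noiseDensity_sub (hσ : 0 < σ) (a : EuclideanSpace ℝ (Fin n)) :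
    ∫ y, noiseDensity σ n (y - a) = 1 := by
  rw [integral_sub_right_eq_self (noiseDensity σ n) a, integral_noiseDensity hσ]

lemma integrable_noiseDensity_sub (hσ : 0 < σ) (a : EuclideanSpace ℝ (Fin n)) :
    Integrable fun y => noiseDensity σ n (y - a) :=
  (integrable_noiseDensity hσ n).comp_sub_right a

lemma setIntegral_noiseDensity_sub_le_one (hσ : 0 < σ) (a : EuclideanSpace ℝ (Fin n))
    (D : Set (EuclideanSpace ℝ (Fin n))) : ∫ y in D, noiseDensity σ n (y - a) ≤ 1 :=
  (setIntegral_le_integral (integrable_noiseDensity_sub hσ a)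
    (Eventually.of_forall fun _ => noiseDensity_nonneg _ _ _)).trans_eq
    (integral_noiseDensity_sub hσ a)

lemma setIntegral_compl_add_setIntegral_noiseDensity_sub (hσ : 0 < σ)
    (a : EuclideanSpace ℝ (Fin n)) {D : Set (EuclideanSpace ℝ (Fin n))} (hD : MeasurableSet D) :
    (∫ y in Dᶜ, noiseDensity σ n (y - a)) + ∫ y in D, noiseDensity σ n (y - a) = 1 := by
  rw [add_comm, integral_add_compl hD (integrable_noiseDensity_sub hσ a),
    integral_noiseDensity_sub hσ a]

/-- Tilting a shifted Gaussian density by `exp (s ‖y - b‖ ^ 2)` gives a multiple of another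
shifted Gaussian density. -/
lemma noiseDensity_sub_mul_exp (hσ : 0 < σ) {s t : ℝ} (ht : t = 1 - 2 * s * σ ^ 2) (ht0 : 0 < t)
    (a b y : EuclideanSpace ℝ (Fin n)) :
    noiseDensity σ n (y - a) * Real.exp (s * ‖y - b‖ ^ 2) =
      (t ^ ((n : ℝ) / 2))⁻¹ * Real.exp (s * ‖a - b‖ ^ 2 / t) *
        noiseDensity (σ / √t) n (y - (b + t⁻¹ • (a - b))) := by
  have hst : (σ / √t) ^ 2 = σ ^ 2 / t := by rw [div_pow, Real.sq_sqrt ht0.le]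
  have hpow : (2 * Real.pi * (σ ^ 2 / t)) ^ ((n : ℝ) / 2) =
      (2 * Real.pi * σ ^ 2) ^ ((n : ℝ) / 2) / t ^ ((n : ℝ) / 2) := by
    rw [← mul_div_assoc, Real.div_rpow (by positivity) ht0.le]
  -- Completing the square: the coefficient of `‖y‖ ^ 2` is `-t / (2σ²)`, whence the new variance
  -- `σ² / t`.
  have hexp : -‖y - a‖ ^ 2 / (2 * σ ^ 2) + s * ‖y - b‖ ^ 2 =
      s * ‖a - b‖ ^ 2 / t + -‖y - (b + t⁻¹ • (a - b))‖ ^ 2 / (2 * (σ ^ 2 / t)) := by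
    have h1 : y - a = (y - b) - (a - b) := by abel
    have h2 : y - (b + t⁻¹ • (a - b)) = (y - b) - t⁻¹ • (a - b) := by abel
    rw [h1, h2, norm_sub_sq_real, norm_sub_sq_real (y - b) (t⁻¹ • (a - b)), norm_smul,
      real_inner_smul_right, mul_pow, Real.norm_eq_abs, sq_abs]
    have hs : s = (1 - t) / (2 * σ ^ 2) := by
      rw [ht]
      field_simp
      ring
    rw [hs]
    field_simp
    ring
  unfold noiseDensity
  rw [hst, hpow, mul_assoc, ← Real.exp_add, hexp, Real.exp_add]
  have h3 : 0 < t ^ ((n : ℝ) / 2) := by positivity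
  have h4 : 0 < (2 * Real.pi * σ ^ 2) ^ ((n : ℝ) / 2) := by positivity
  field_simp

/-- Chernoff's bound for the squared distance of a Gaussian vector from a point. -/
lemma setIntegral_noiseDensity_sub_le_exp (hσ : 0 < σ) {s t τ : ℝ} (ht : t = 1 - 2 * s * σ ^ 2)
    (ht0 : 0 < t) (a b : EuclideanSpace ℝ (Fin n)) {D : Set (EuclideanSpace ℝ (Fin n))}
    (hD : MeasurableSet D) (hτ : ∀ y ∈ D, s * τ ≤ s * ‖y - b‖ ^ 2) :
    ∫ y in D, noiseDensity σ n (y - a) ≤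
      Real.exp (-(s * τ)) * (t ^ ((n : ℝ) / 2))⁻¹ * Real.exp (s * ‖a - b‖ ^ 2 / t) := by
  have hρ : 0 < σ / √t := by positivity
  set c := b + t⁻¹ • (a - b) with hc
  set K := Real.exp (-(s * τ)) * (t ^ ((n : ℝ) / 2))⁻¹ * Real.exp (s * ‖a - b‖ ^ 2 / t) with hK
  calc ∫ y in D, noiseDensity σ n (y - a)
      ≤ ∫ y in D, K * noiseDensity (σ / √t) n (y - c) := by
        refine setIntegral_mono_on (integrable_noiseDensity_sub hσ a).integrableOn
          ((integrable_noiseDensity_sub hρ c).const_mul K).integrableOn hD fun y hy => ?_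
        have := noiseDensity_sub_mul_exp hσ ht ht0 a b y
        rw [hK, mul_assoc (Real.exp _), mul_assoc (Real.exp _), ← this, mul_left_comm,
          ← Real.exp_add]
        refine le_mul_of_one_le_right (noiseDensity_nonneg _ _ _) (Real.one_le_exp ?_)
        linarith [hτ y hy]
    _ = K * ∫ y in D, noiseDensity (σ / √t) n (y - c) := integral_const_mul _ _
    _ ≤ K := mul_le_of_le_one_right (by positivity)
        (setIntegral_noiseDensity_sub_le_one hρ c D)

/-- The probabilities of an event under two Gaussian laws with nearby centres are comparable,
uniformly in the dimension. -/
lemma setIntegral_noiseDensity_sub_le_mul (hσ : 0 < σ) (a b : EuclideanSpace ℝ (Fin n))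
    (D : Set (EuclideanSpace ℝ (Fin n))) :
    ∫ y in D, noiseDensity σ n (y - a) ≤ Real.exp (‖a - b‖ ^ 2 / (2 * σ ^ 2)) *
      ((∫ y in D, noiseDensity σ n (y - b)) + 1 / 4) := by
  set E := Real.exp (‖a - b‖ ^ 2 / (2 * σ ^ 2)) with hE
  -- The reflection of `b` in `a`: the density at `a` is `E` times the geometric mean of those at
  -- `b` and `c`. Weighted AM-GM leaves only mass 1/4 from `c`.
  set c := (2 : ℝ) • a - b with hc
  have hpt : ∀ y, noiseDensity σ n (y - a) ≤
      E * (noiseDensity σ n (y - b) + 1 / 4 * noiseDensity σ n (y - c)) := by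
    intro y
    have hsq : noiseDensity σ n (y - a) ^ 2 =
        E ^ 2 * (noiseDensity σ n (y - b) * noiseDensity σ n (y - c)) := by
      have key : 2 * ‖y - a‖ ^ 2 = ‖y - b‖ ^ 2 + ‖y - c‖ ^ 2 - 2 * ‖a - b‖ ^ 2 := by
        have h1 : y - a = (y - b) - (a - b) := by abel
        have h2 : y - c = (y - b) - (2 : ℝ) • (a - b) := by
          rw [hc, smul_sub, two_smul, two_smul]
          abel
        rw [h1, h2, norm_sub_sq_real, norm_sub_sq_real (y - b) ((2 : ℝ) • (a - b)), norm_smul,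
          real_inner_smul_right, mul_pow, Real.norm_eq_abs, sq_abs]
        ring
      have key' : -‖y - a‖ ^ 2 / (2 * σ ^ 2) + -‖y - a‖ ^ 2 / (2 * σ ^ 2) =
          ‖a - b‖ ^ 2 / (2 * σ ^ 2) + ‖a - b‖ ^ 2 / (2 * σ ^ 2) +
          (-‖y - b‖ ^ 2 / (2 * σ ^ 2) + -‖y - c‖ ^ 2 / (2 * σ ^ 2)) := by
        field_simp
        linarith
      have key'' := congrArg Real.exp key'
      rw [Real.exp_add, Real.exp_add, Real.exp_add, Real.exp_add, ← hE] at key''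
      unfold noiseDensity
      linear_combination (1 / (2 * Real.pi * σ ^ 2) ^ ((n : ℝ) / 2)) ^ 2 * key''
    have hb := noiseDensity_nonneg σ n (y - b)
    have hc' := noiseDensity_nonneg σ n (y - c)
    refine le_of_sq_le_sq ?_ (by positivity)
    rw [hsq, mul_pow]
    gcongr
    nlinarith [sq_nonneg (noiseDensity σ n (y - b) - 1 / 4 * noiseDensity σ n (y - c))]
  have ib := (integrable_noiseDensity_sub hσ b).integrableOn (s := D)
  have ic := ((integrable_noiseDensity_sub hσ c).const_mul (1 / 4)).integrableOn (s := D)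
  calc ∫ y in D, noiseDensity σ n (y - a)
      ≤ ∫ y in D, E * (noiseDensity σ n (y - b) + 1 / 4 * noiseDensity σ n (y - c)) :=
        integral_mono (integrable_noiseDensity_sub hσ a).integrableOn
          ((ib.add ic).const_mul E) hpt
    _ = E * ((∫ y in D, noiseDensity σ n (y - b)) +
          1 / 4 * ∫ y in D, noiseDensity σ n (y - c)) := by
        rw [integral_const_mul, integral_add ib ic, integral_const_mul]
    _ ≤ _ := by
        gcongr
        linarith [setIntegral_noiseDensity_sub_le_one hσ c D]

end Noise

-- Packing in Euclidean balls

section Packing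

variable {n : ℕ}

/-- Greedy packing: as long as `k ≤ (r / d) ^ n`, the ball of radius `r` contains `k` points at
mutual distance at least `d`. -/
lemma exists_separated {r d : ℝ} (hr : 0 < r) (hd : 0 < d) (k : ℕ)
    (hk : (k : ℝ) ≤ (r / d) ^ n) :
    ∃ u : Fin k → EuclideanSpace ℝ (Fin n), (∀ i, ‖u i‖ ≤ r) ∧
      ∀ i j, i ≠ j → d ≤ ‖u i - u j‖ := by
  induction k with
  | zero => exact ⟨Fin.elim0, fun i => i.elim0, fun i => i.elim0⟩
  | succ k ih =>
    push_cast at hk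
    obtain ⟨u, hu, hsep⟩ := ih (by linarith)
    have : ∃ x : EuclideanSpace ℝ (Fin n), ‖x‖ ≤ r ∧ ∀ i, d ≤ ‖x - u i‖ := by
      -- If no point can be added, the `d`-balls cover the `r`-ball, so `r ^ n ≤ k * d ^ n`, against
      -- `hk`.
      by_contra! hcon
      have hsub : Metric.closedBall (0 : EuclideanSpace ℝ (Fin n)) r ⊆
          ⋃ i, Metric.closedBall (u i) d := by
        intro x hx
        obtain ⟨i, hi⟩ := hcon x (by simpa using hx)
        exact Set.mem_iUnion.2 ⟨i, by simpa [dist_eq_norm] using hi.le⟩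
      have hle := (measure_mono (μ := volume) hsub).trans (measure_iUnion_le _)
      have hB0 : volume (Metric.ball (0 : EuclideanSpace ℝ (Fin n)) 1) ≠ 0 :=
        (Metric.measure_ball_pos _ _ one_pos).ne'
      have hBt : volume (Metric.ball (0 : EuclideanSpace ℝ (Fin n)) 1) ≠ ⊤ :=
        measure_ball_lt_top.ne
      simp only [tsum_fintype, Measure.addHaar_closedBall _ _ hr.le,
        Measure.addHaar_closedBall _ _ hd.le, Finset.sum_const, Finset.card_univ,
        Fintype.card_fin, nsmul_eq_mul, finrank_euclideanSpace_fin, ← mul_assoc] at hle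
      rw [ENNReal.mul_le_mul_iff_left hB0 hBt, ← ENNReal.ofReal_natCast,
        ← ENNReal.ofReal_mul (by positivity), ENNReal.ofReal_le_ofReal_iff (by positivity)] at hle
      rw [div_pow, le_div_iff₀ (by positivity)] at hk
      have : 0 < d ^ n := by positivity
      linarith
    obtain ⟨x, hx, hxu⟩ := this
    refine ⟨Fin.cons x u, fun i => ?_, fun i j hij => ?_⟩
    · cases i using Fin.cases <;> simp [hx, hu]
    · cases i using Fin.cases <;> cases j using Fin.cases
      · exact absurd rfl hij
      · simpa using hxu _
      · simpa [norm_sub_rev] using hxu _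
      · simpa using hsep _ _ (fun h => hij (by rw [h]))

/-- Volume bound for the number of separated points in a ball. -/
lemma card_le_of_separated {M : ℕ} {r d : ℝ} (hr : 0 ≤ r) (hd : 0 < d)
    (u : Fin M → EuclideanSpace ℝ (Fin n)) (hu : ∀ i, ‖u i‖ ≤ r)
    (hsep : ∀ i j, i ≠ j → d ≤ ‖u i - u j‖) : (M : ℝ) ≤ (2 * r / d + 1) ^ n := by
  have hd2 : 0 < d / 2 := by positivity
  have hsub : (⋃ i, Metric.ball (u i) (d / 2)) ⊆
      Metric.ball (0 : EuclideanSpace ℝ (Fin n)) (r + d / 2) := by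
    refine Set.iUnion_subset fun i => Metric.ball_subset_ball' ?_
    rw [dist_zero_right]
    linarith [hu i]
  have hdis : Pairwise (Function.onFun Disjoint fun i => Metric.ball (u i) (d / 2)) := by
    intro i j hij
    refine Metric.ball_disjoint_ball ?_
    rw [dist_eq_norm]
    linarith [hsep i j hij]
  have hle := measure_mono (μ := volume) hsub
  rw [measure_iUnion hdis fun i => measurableSet_ball] at hle
  have hB0 : volume (Metric.ball (0 : EuclideanSpace ℝ (Fin n)) 1) ≠ 0 :=
    (Metric.measure_ball_pos _ _ one_pos).ne'
  have hBt : volume (Metric.ball (0 : EuclideanSpace ℝ (Fin n)) 1) ≠ ⊤ :=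
    measure_ball_lt_top.ne
  have hrd : 0 < r + d / 2 := by positivity
  simp only [tsum_fintype, Measure.addHaar_ball_of_pos _ _ hrd,
    Measure.addHaar_ball_of_pos _ _ hd2, Finset.sum_const, Finset.card_univ,
    Fintype.card_fin, nsmul_eq_mul, finrank_euclideanSpace_fin, ← mul_assoc] at hle
  rw [ENNReal.mul_le_mul_iff_left hB0 hBt, ← ENNReal.ofReal_natCast,
    ← ENNReal.ofReal_mul (by positivity), ENNReal.ofReal_le_ofReal_iff (by positivity),
    ← le_div_iff₀ (by positivity), ← div_pow] at hle
  refine hle.trans_eq ?_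
  congr 1
  field_simp

end Packing

-- Errors of the typical-ball decoder

section Typicality

variable {σ : ℝ} {n : ℕ}

/-- Second-order expansion of the logarithm. For `x = ±2/√n` and `p = n/2` the linear term is `±√n`,
which cancels the centring, and the quadratic one is the constant 4. -/
lemma inv_rpow_one_sub_le_exp {x : ℝ} (hx : |x| ≤ 1 / 2) {p : ℝ} (hp : 0 ≤ p) :
    ((1 - x) ^ p)⁻¹ ≤ Real.exp (p * (x + 2 * x ^ 2)) := by
  have hx' := abs_le.1 hx
  have h1 : 0 < 1 - x := by linarith
  have hlog : -(x + 2 * x ^ 2) ≤ Real.log (1 - x) := by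
    have h := (abs_le.1 (Real.abs_log_sub_add_sum_range_le (x := x) (by linarith) 1)).1
    have h2 : |x| ^ (1 + 1) / (1 - |x|) ≤ 2 * x ^ 2 := by
      rw [div_le_iff₀ (by linarith), ← sq_abs x, one_add_one_eq_two]
      nlinarith [mul_nonneg (sq_nonneg |x|) (sub_nonneg.2 hx)]
    simp at h h2
    linarith
  rw [Real.rpow_def_of_pos h1, ← Real.exp_neg, Real.exp_le_exp]
  nlinarith [mul_le_mul_of_nonneg_right hlog hp]

/-- The closed ball of the outputs that are typical for the (faded) codeword `a`. -/
def typicalBall (σ : ℝ) (n : ℕ) (T : ℝ) (a : EuclideanSpace ℝ (Fin n)) :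
    Set (EuclideanSpace ℝ (Fin n)) :=
  {y | ‖y - a‖ ^ 2 ≤ σ ^ 2 * (n + T * √n)}

lemma measurableSet_typicalBall (σ : ℝ) (T : ℝ) (a : EuclideanSpace ℝ (Fin n)) :
    MeasurableSet (typicalBall σ n T a) :=
  (isClosed_le (by fun_prop) continuous_const).measurableSet

/-- Chernoff with `s = 1/(σ²√n)`, matched to the fluctuations of the squared norm; `16 ≤ n` gives
`2/√n ≤ 1/2`. -/
lemma setIntegral_compl_typicalBall_le (hσ : 0 < σ) (hn : 16 ≤ n) (T : ℝ)
    (a : EuclideanSpace ℝ (Fin n)) :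
    ∫ y in (typicalBall σ n T a)ᶜ, noiseDensity σ n (y - a) ≤ Real.exp (4 - T) := by
  have hq : 4 ≤ √(n : ℝ) := Real.le_sqrt_of_sq_le (by norm_num; exact_mod_cast hn)
  have hqq : √(n : ℝ) * √n = n := Real.mul_self_sqrt (by positivity)
  set q := √(n : ℝ) with hqdef
  have hx : |2 / q| ≤ 1 / 2 := by
    rw [abs_of_pos (by positivity), div_le_div_iff₀ (by positivity) (by norm_num)]
    linarith
  have ht : 1 - 2 / q = 1 - 2 * (1 / (σ ^ 2 * q)) * σ ^ 2 := by field_simp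
  have ht0 : 0 < 1 - 2 / q := by linarith [(abs_le.1 hx).2]
  refine (setIntegral_noiseDensity_sub_le_exp hσ (τ := σ ^ 2 * (n + T * q)) ht ht0 a a
    (measurableSet_typicalBall σ T a).compl fun y hy => ?_).trans ?_
  · have hy' : σ ^ 2 * (n + T * q) < ‖y - a‖ ^ 2 := not_le.1 hy
    gcongr
  · rw [sub_self, norm_zero, ← hqq]
    have h := inv_rpow_one_sub_le_exp hx (p := (q * q) / 2) (by positivity)
    have e : 1 / (σ ^ 2 * q) * 0 ^ 2 / (1 - 2 / q) = 0 := by simp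
    rw [e, Real.exp_zero, mul_one]
    grw [h]
    rw [← Real.exp_add, Real.exp_le_exp]
    field_simp
    linarith

/-- Chernoff for the lower tail, with `s = -1/(σ²√n)`. The factor 2 in the denominator comes from `t
= 1 + 2/√n ≤ 2`. -/
lemma setIntegral_typicalBall_le (hσ : 0 < σ) (hn : 16 ≤ n) (T : ℝ)
    (a b : EuclideanSpace ℝ (Fin n)) :
    ∫ y in typicalBall σ n T b, noiseDensity σ n (y - a) ≤
      Real.exp (T + 4 - ‖a - b‖ ^ 2 / (2 * σ ^ 2 * √n)) := by
  have hq : 4 ≤ √(n : ℝ) := Real.le_sqrt_of_sq_le (by norm_num; exact_mod_cast hn)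
  have hqq : √(n : ℝ) * √n = n := Real.mul_self_sqrt (by positivity)
  set q := √(n : ℝ) with hqdef
  have hx : |-(2 / q)| ≤ 1 / 2 := by
    rw [abs_neg, abs_of_pos (by positivity), div_le_div_iff₀ (by positivity) (by norm_num)]
    linarith
  have ht : 1 - -(2 / q) = 1 - 2 * (-(1 / (σ ^ 2 * q))) * σ ^ 2 := by field_simp
  have ht0 : 0 < 1 - -(2 / q) := by linarith [(abs_le.1 hx).2]
  refine (setIntegral_noiseDensity_sub_le_exp hσ (τ := σ ^ 2 * (n + T * q)) ht ht0 a b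
    (measurableSet_typicalBall σ T b) fun y hy => ?_).trans ?_
  · have hy' : ‖y - b‖ ^ 2 ≤ σ ^ 2 * (n + T * q) := hy
    rw [neg_mul, neg_mul, neg_le_neg_iff]
    gcongr
  · have h := inv_rpow_one_sub_le_exp hx (p := (q * q) / 2) (by positivity)
    have e : -(1 / (σ ^ 2 * q)) * ‖a - b‖ ^ 2 / (1 - -(2 / q)) ≤
        - (‖a - b‖ ^ 2 / (2 * σ ^ 2 * q)) := by
      have e1 : -(1 / (σ ^ 2 * q)) * ‖a - b‖ ^ 2 / (1 - -(2 / q)) =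
          - (‖a - b‖ ^ 2 / ((1 - -(2 / q)) * (σ ^ 2 * q))) := by field_simp
      rw [e1, neg_le_neg_iff, mul_assoc 2]
      have : 1 - -(2 / q) ≤ 2 := by linarith [(abs_le.1 hx).1]
      gcongr
    rw [← hqq]
    grw [h, e]
    rw [← Real.exp_add, ← Real.exp_add, Real.exp_le_exp]
    have e2 : -(-(1 / (σ ^ 2 * q)) * (σ ^ 2 * (q * q + T * q))) = q + T := by field_simp
    have e3 : q * q / 2 * (-(2 / q) + 2 * (-(2 / q)) ^ 2) = - q + 4 := by
      field_simp
      ring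
    linarith

end Typicality

-- Codes, converse and achievability

section Capacity

variable {Ω : Type*} [MeasurableSpace Ω] {P : Measure Ω} {h : Ω → ℝ} {σ A η : ℝ}

lemma one_lt_rpow_eventually {R : ℝ} (hR : 0 < R) :
    ∀ᶠ n : ℕ in atTop, 1 < (n : ℝ) ^ ((n : ℝ) * R) := by
  filter_upwards [eventually_ge_atTop 2] with n hn
  have : (2 : ℝ) ≤ n := by exact_mod_cast hn
  exact Real.one_lt_rpow (by linarith) (by positivity)

lemma ExistsDICode.card_le_one [IsProbabilityMeasure P] (hh : Measurable h) (hσ : 0 < σ)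
    (hη : η < P.real {ω | h ω = 0}) {M n : ℕ} {lam₁ lam₂ : ℝ} (hlam : lam₁ + lam₂ < 1)
    (hC : ExistsDICode σ A P h M n lam₁ lam₂ η) : M ≤ 1 := by
  obtain ⟨𝒞, H₀, hH, hP, hI, hII⟩ := hC
  by_contra! hM
  -- The excluded fading values have probability at most `η`, too little to contain `h = 0`.
  have h0 : (0 : ℝ) ∈ H₀ := by
    by_contra h0
    have hsub : {ω | h ω ∈ H₀} ⊆ {ω | h ω = 0}ᶜ := fun ω hω h' => h0 (h' ▸ hω)
    have h1 := measureReal_mono (μ := P) hsub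
    rw [probReal_compl_eq_one_sub (measurableSet_eq_fun hh measurable_const)] at h1
    linarith
  let i : Fin M := ⟨0, by omega⟩
  let j : Fin M := ⟨1, hM⟩
  have h1 := hI j 0 h0
  have h2 := hII i j (by simp [i, j]) 0 h0
  have h3 := setIntegral_compl_add_setIntegral_noiseDensity_sub hσ
    (0 : EuclideanSpace ℝ (Fin n)) (𝒞.measurableSet_region j 0)
  simp only [DICode.errorI, DICode.errorII, zero_smul] at h1 h2
  linarith

lemma capacity_eq_zero [IsProbabilityMeasure P] (hh : Measurable h) (hσ : 0 < σ)
    (hη : η < P.real {ω | h ω = 0}) : capacity σ A P h η = 0 := by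
  simp only [capacity, ENNReal.iSup_eq_zero]
  rintro R ⟨hR, hach⟩
  obtain ⟨n, hn, hcode⟩ := ((one_lt_rpow_eventually hR).and
    (hach (1 / 4) (1 / 4) (by norm_num) (by norm_num))).exists
  have := hcode.card_le_one hh hσ hη (by norm_num)
  exact absurd (Nat.le_ceil _) (not_le.2 (hn.trans_le' (by exact_mod_cast this)))

/-- The fading coefficient is bounded with probability more than `η`. -/
lemma exists_lt_measureReal_abs_le [IsProbabilityMeasure P] (h : Ω → ℝ) (hη : η < 1) :
    ∃ K : ℝ, 0 < K ∧ η < P.real {ω | |h ω| ≤ K} := by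
  have hmono : Monotone fun k : ℕ => {ω | |h ω| ≤ k} := by
    intro k l hkl ω (hω : |h ω| ≤ k)
    exact hω.trans (by exact_mod_cast hkl)
  have hU : (⋃ k : ℕ, {ω | |h ω| ≤ k}) = Set.univ :=
    Set.eq_univ_of_forall fun ω => Set.mem_iUnion.2 (exists_nat_ge |h ω|)
  have ht := tendsto_measure_iUnion_atTop (μ := P) hmono
  rw [hU, measure_univ] at ht
  have ht' := (ENNReal.tendsto_toReal ENNReal.one_ne_top).comp ht
  obtain ⟨k, hk, hk0⟩ := ((ht'.eventually (lt_mem_nhds (by simpa using hη))).and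
    (eventually_gt_atTop 0)).exists
  exact ⟨k, by exact_mod_cast hk0, hk⟩

/-- The fading coefficient is bounded away from `0` with probability at least `1 - η`. -/
lemma exists_le_measureReal_le_abs [IsProbabilityMeasure P] (hh : Measurable h)
    (hη : P.real {ω | h ω = 0} < η) :
    ∃ γ : ℝ, 0 < γ ∧ 1 - η ≤ P.real {ω | γ ≤ |h ω|} := by
  have hmono : Monotone fun k : ℕ => {ω | 1 / ((k : ℝ) + 1) ≤ |h ω|} := by
    intro k l hkl ω (hω : 1 / ((k : ℝ) + 1) ≤ |h ω|)
    exact (one_div_le_one_div_of_le (by positivity) (by gcongr)).trans hω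
  have hU : (⋃ k : ℕ, {ω | 1 / ((k : ℝ) + 1) ≤ |h ω|}) = {ω | h ω = 0}ᶜ := by
    ext ω
    simp only [Set.mem_iUnion, Set.mem_compl_iff, Set.mem_ofPred_eq]
    constructor
    · rintro ⟨k, hk⟩ h0
      rw [h0, abs_zero] at hk
      exact absurd hk (not_le.2 (by positivity))
    · intro h0
      obtain ⟨k, hk⟩ := exists_nat_one_div_lt (abs_pos.2 h0)
      exact ⟨k, hk.le⟩
  have ht := tendsto_measure_iUnion_atTop (μ := P) hmono
  rw [hU] at ht
  have ht' := (ENNReal.tendsto_toReal (measure_ne_top P _)).comp ht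
  have hlt : 1 - η < (P {ω | h ω = 0}ᶜ).toReal := by
    change 1 - η < P.real {ω | h ω = 0}ᶜ
    rw [probReal_compl_eq_one_sub (measurableSet_eq_fun hh measurable_const)]
    linarith
  obtain ⟨k, hk⟩ := (ht'.eventually (lt_mem_nhds hlt)).exists
  exact ⟨1 / ((k : ℝ) + 1), by positivity, hk.le⟩

/-- The codewords of a code with error probabilities at most `1 / 4` are separated, uniformly in
the block length. -/
lemma DICode.IsReliable.le_norm_sub [IsProbabilityMeasure P] (hh : Measurable h) (hσ : 0 < σ)
    {K : ℝ} (hK : 0 < K) (hPK : η < P.real {ω | |h ω| ≤ K}) {M n : ℕ} {𝒞 : DICode M n A}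
    (hC : 𝒞.IsReliable σ P h (1 / 4) (1 / 4) η) {i j : Fin M} (hij : i ≠ j) :
    σ * √(2 * Real.log (3 / 2)) / K ≤ ‖𝒞.codeword i - 𝒞.codeword j‖ := by
  obtain ⟨H₀, hH, hP, hI, hII⟩ := hC
  obtain ⟨x, hx, hxK⟩ : ∃ x ∈ H₀, |x| ≤ K := by
    by_contra! hcon
    have hsub : {ω | h ω ∈ H₀} ⊆ {ω | |h ω| ≤ K}ᶜ := fun ω hω => not_le.2 (hcon _ hω)
    have h1 := measureReal_mono (μ := P) hsub
    rw [probReal_compl_eq_one_sub (measurableSet_le hh.abs measurable_const)] at h1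
    linarith
  have h1 := hI i x hx
  have h2 := hII j i hij.symm x hx
  have h3 := setIntegral_compl_add_setIntegral_noiseDensity_sub hσ (x • 𝒞.codeword i)
    (𝒞.measurableSet_region i x)
  have h4 := setIntegral_noiseDensity_sub_le_mul hσ (x • 𝒞.codeword i) (x • 𝒞.codeword j)
    (𝒞.region i x)
  simp only [DICode.errorI, DICode.errorII] at h1 h2
  set v := ‖x • 𝒞.codeword i - x • 𝒞.codeword j‖ with hv
  -- The four estimates combine to `3/4 ≤ E * (1/4 + 1/4)`, with `E` this exponential.
  have h5 : 3 / 2 ≤ Real.exp (v ^ 2 / (2 * σ ^ 2)) := by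
    nlinarith [Real.exp_pos (v ^ 2 / (2 * σ ^ 2))]
  have h6 : Real.log (3 / 2) ≤ v ^ 2 / (2 * σ ^ 2) := (Real.log_le_iff_le_exp (by norm_num)).2 h5
  have h7 : v ≤ ‖𝒞.codeword i - 𝒞.codeword j‖ * K := by
    rw [hv, ← smul_sub, norm_smul, mul_comm, Real.norm_eq_abs]
    gcongr
  rw [div_le_iff₀ hK]
  refine le_trans (abs_le_of_sq_le_sq' ?_ (norm_nonneg _)).2 h7
  have hl : 0 ≤ Real.log (3 / 2) := Real.log_nonneg (by norm_num)
  rw [le_div_iff₀ (by positivity)] at h6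
  rw [mul_pow, Real.sq_sqrt (by positivity)]
  linarith

lemma IsAchievable.le_half [IsProbabilityMeasure P] (hh : Measurable h) (hσ : 0 < σ)
    (hA : 0 < A) (hη : η < 1) {R : ℝ} (hR : IsAchievable σ A P h η R) : R ≤ 1 / 2 := by
  obtain ⟨K, hK, hPK⟩ := exists_lt_measureReal_abs_le (P := P) h hη
  have hl : 0 < Real.log (3 / 2) := Real.log_pos (by norm_num)
  set d := σ * √(2 * Real.log (3 / 2)) / K with hd
  have hd0 : 0 < d := by positivity
  by_contra! hlt
  have hlim : Tendsto (fun n : ℕ => (n : ℝ) ^ (R - 1 / 2)) atTop atTop :=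
    (tendsto_rpow_atTop (by linarith)).comp tendsto_natCast_atTop_atTop
  obtain ⟨n, ⟨hn, hn1⟩, 𝒞, h𝒞⟩ := (((hlim.eventually_gt_atTop (2 * √A / d + 1)).and
    (eventually_ge_atTop 1)).and (hR.2 (1 / 4) (1 / 4) (by norm_num) (by norm_num))).exists
  have hn0 : (1 : ℝ) ≤ n := by exact_mod_cast hn1
  have hcard := card_le_of_separated (r := √(n * A)) (by positivity) hd0 𝒞.codeword
    (fun i => Real.le_sqrt_of_sq_le (𝒞.norm_sq_le i))
    (fun i j hij => h𝒞.le_norm_sub hh hσ hK hPK hij)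
  have hpow : ((n : ℝ) ^ R) ^ n ≤ (2 * √(n * A) / d + 1) ^ n := by
    refine le_trans ?_ ((Nat.le_ceil _).trans hcard)
    rw [← Real.rpow_mul_natCast (by positivity), mul_comm]
  -- Taking `n`-th roots leaves `n ^ R` bounded by a constant times `√n`.
  have hbase := (pow_le_pow_iff_left₀ (by positivity) (by positivity) (by omega)).1 hpow
  have hs : 1 ≤ √(n : ℝ) := Real.one_le_sqrt.2 hn0
  have h1 : 2 * √(n * A) / d + 1 ≤ (2 * √A / d + 1) * √n := by
    rw [Real.sqrt_mul (by positivity), add_mul, one_mul]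
    refine add_le_add (le_of_eq ?_) hs
    ring
  rw [Real.rpow_sub (by positivity), ← Real.sqrt_eq_rpow, lt_div_iff₀ (by positivity)] at hn
  linarith

lemma isAchievable_of_lt [IsProbabilityMeasure P] (hh : Measurable h) (hσ : 0 < σ)
    (hA : 0 < A) (hη : P.real {ω | h ω = 0} < η) {R : ℝ} (hR0 : 0 < R) (hR : R < 1 / 4) :
    IsAchievable σ A P h η R := by
  obtain ⟨γ, hγ, hPγ⟩ := exists_le_measureReal_le_abs hh hη
  refine ⟨hR0, fun lam₁ lam₂ h₁ h₂ => ?_⟩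
  -- With distance `n ^ (1/4 + b)`, packing has base `√A * n ^ b * n ^ R`: one surplus `b` serves
  -- the type II error, the other the count.
  set b := (1 / 4 - R) / 2 with hb
  have hb0 : 0 < b := by linarith
  set T := 4 - Real.log lam₁ with hT
  have hlim : ∀ c : ℝ, 0 < c → Tendsto (fun n : ℕ => (n : ℝ) ^ c) atTop atTop := fun c hc =>
    (tendsto_rpow_atTop hc).comp tendsto_natCast_atTop_atTop
  -- The first condition gives the factor 2 that absorbs the ceiling; the second makes the type II
  -- error at most `lam₂`.
  filter_upwards [(hlim b hb0).eventually_ge_atTop (2 / √A),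
    (hlim (2 * b) (by positivity)).eventually_ge_atTop
      ((T + 4 - Real.log lam₂) * (2 * σ ^ 2) / γ ^ 2),
    eventually_ge_atTop 16] with n hnA hnγ hn
  have hn0 : (1 : ℝ) ≤ n := by exact_mod_cast (by omega : 1 ≤ n)
  have hnpos : (0 : ℝ) < n := by linarith
  have hratio : √(n * A) / (n : ℝ) ^ (1 / 4 + b) = √A * (n : ℝ) ^ b * (n : ℝ) ^ R := by
    rw [div_eq_iff (by positivity), Real.sqrt_mul hnpos.le, Real.sqrt_eq_rpow, mul_assoc, mul_assoc,
      ← Real.rpow_add hnpos, ← Real.rpow_add hnpos, mul_comm]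
    congr 2
    rw [hb]
    ring
  have hcard : (⌈(n : ℝ) ^ ((n : ℝ) * R)⌉₊ : ℝ) ≤ (√(n * A) / (n : ℝ) ^ (1 / 4 + b)) ^ n := by
    have h1 : (1 : ℝ) ≤ (n : ℝ) ^ ((n : ℝ) * R) := Real.one_le_rpow hn0 (by positivity)
    have h2 : (2 : ℝ) ≤ √A * (n : ℝ) ^ b := by
      rw [div_le_iff₀ (by positivity)] at hnA
      linarith
    have h3 : (2 : ℝ) ≤ (√A * (n : ℝ) ^ b) ^ n :=
      h2.trans (le_self_pow₀ (by linarith) (by omega))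
    calc (⌈(n : ℝ) ^ ((n : ℝ) * R)⌉₊ : ℝ) ≤ (n : ℝ) ^ ((n : ℝ) * R) + 1 :=
          (Nat.ceil_lt_add_one (by positivity)).le
      _ ≤ 2 * (n : ℝ) ^ ((n : ℝ) * R) := by linarith
      _ ≤ (√A * (n : ℝ) ^ b) ^ n * (n : ℝ) ^ ((n : ℝ) * R) := by gcongr
      _ = _ := by
        rw [hratio, mul_pow _ ((n : ℝ) ^ R), ← Real.rpow_mul_natCast hnpos.le, mul_comm R]
  obtain ⟨u, hu, hsep⟩ := exists_separated (by positivity) (by positivity) _ hcard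
  let 𝒞 : DICode ⌈(n : ℝ) ^ ((n : ℝ) * R)⌉₊ n A :=
    { codeword := u
      region := fun i x => typicalBall σ n T (x • u i)
      norm_sq_le := fun i => (Real.le_sqrt (norm_nonneg _) (by positivity)).1 (hu i)
      measurableSet_region := fun i x => measurableSet_typicalBall σ T (x • u i) }
  refine ⟨𝒞, {x | γ ≤ |x|}, measurableSet_le measurable_const measurable_id.abs, hPγ,
    fun i x _ => ?_, fun i j hij x hx => ?_⟩
  · refine (setIntegral_compl_typicalBall_le hσ hn T (x • u i)).trans_eq ?_
    rw [hT, sub_sub_cancel, Real.exp_log h₁]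
  · refine (setIntegral_typicalBall_le hσ hn T (x • u i) (x • u j)).trans ?_
    rw [← Real.le_log_iff_exp_le h₂]
    have hx' : γ ≤ |x| := hx
    have hdist : γ * (n : ℝ) ^ (1 / 4 + b) ≤ ‖x • u i - x • u j‖ := by
      rw [← smul_sub, norm_smul, Real.norm_eq_abs]
      exact mul_le_mul hx' (hsep i j hij) (by positivity) (abs_nonneg x)
    have hsq : γ ^ 2 * ((n : ℝ) ^ (2 * b) * √n) ≤ ‖x • u i - x • u j‖ ^ 2 := by
      calc γ ^ 2 * ((n : ℝ) ^ (2 * b) * √n) = (γ * (n : ℝ) ^ (1 / 4 + b)) ^ 2 := by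
            rw [mul_pow, Real.sqrt_eq_rpow, ← Real.rpow_add hnpos, ← Real.rpow_mul_natCast hnpos.le]
            congr 2
            push_cast
            ring
        _ ≤ _ := by gcongr
    have hs : 0 < √(n : ℝ) := by positivity
    rw [div_le_iff₀ (by positivity)] at hnγ
    have : T + 4 - Real.log lam₂ ≤ ‖x • u i - x • u j‖ ^ 2 / (2 * σ ^ 2 * √n) := by
      rw [le_div_iff₀ (by positivity)]
      nlinarith [mul_le_mul_of_nonneg_right hnγ hs.le]
    linarith

lemma capacity_le_half [IsProbabilityMeasure P] (hh : Measurable h) (hσ : 0 < σ)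
    (hA : 0 < A) (hη : η < 1) : capacity σ A P h η ≤ 1 / 2 := by
  refine iSup₂_le fun R hR => ?_
  refine (ENNReal.ofReal_le_ofReal (hR.le_half hh hσ hA hη)).trans_eq ?_
  rw [ENNReal.ofReal_div_of_pos two_pos, ENNReal.ofReal_one, ENNReal.ofReal_ofNat]

lemma quarter_le_capacity [IsProbabilityMeasure P] (hh : Measurable h) (hσ : 0 < σ)
    (hA : 0 < A) (hη : P.real {ω | h ω = 0} < η) : 1 / 4 ≤ capacity σ A P h η := by
  have e : (1 / 4 : ℝ≥0∞) = ENNReal.ofReal (1 / 4) := by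
    rw [ENNReal.ofReal_div_of_pos (by norm_num), ENNReal.ofReal_one, ENNReal.ofReal_ofNat]
  rw [e]
  -- Achievability is known only for `R < 1/4`, so the bound is reached as a limit from the left.
  refine le_of_tendsto (f := fun R => ENNReal.ofReal R) (x := nhdsWithin (1 / 4) (Set.Iio (1 / 4)))
    (ENNReal.continuous_ofReal.continuousWithinAt) ?_
  filter_upwards [Ioo_mem_nhdsLT (show (0 : ℝ) < 1 / 4 by norm_num)] with R hR
  exact le_iSup₂_of_le R (isAchievable_of_lt hh hσ hA hη hR.1 hR.2) le_rfl

end Capacity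

end SlowFading

theorem mainTheorem2 {Ω : Type*} [MeasurableSpace Ω] (P : Measure Ω) [IsProbabilityMeasure P]
    (h : Ω → ℝ) (hh : Measurable h) (σ A : ℝ) (hσ : 0 < σ) (hA : 0 < A) (η : ℝ) :
    (η < P.real {ω | h ω = 0} →
      SlowFading.capacity σ A P h η = 0 ∧
      ∀ (M n : ℕ) (lam₁ lam₂ : ℝ), lam₁ + lam₂ < 1 →
        SlowFading.ExistsDICode σ A P h M n lam₁ lam₂ η → M ≤ 1) ∧
    (P.real {ω | h ω = 0} < η → η < 1 →
      1 / 4 ≤ SlowFading.capacity σ A P h η ∧ SlowFading.capacity σ A P h η ≤ 1 / 2) :=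
  ⟨fun hη => ⟨SlowFading.capacity_eq_zero hh hσ hη,
    fun _ _ _ _ hlam hC => hC.card_le_one hh hσ hη hlam⟩,
  fun hη hη1 => ⟨SlowFading.quarter_le_capacity hh hσ hA hη,
    SlowFading.capacity_le_half hh hσ hA hη1⟩⟩
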